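/- Let $n\ge 2$, $\kappa>0$, and let $h:(0,\infty)\to[0,\infty)$ be a $C^1$ function, twice differentiable with $h''(d)>0$ for all $d>0$, such that $$\lim_{d\to0^+}h(d)=\infty,\quad \lim_{d\to\infty}\frac{h(d)}{d}=\infty,\quad \lim_{d\to0^+}h'(d)=-\infty,\quad \lim_{d\to\infty}h'(d)=\infty,$$ and such that for some constants $K,\gamma_0>0$ one has $|d\,h'(cd)|\le K\,[h(d)+1]$ for all $d>0$ and all $c>0$ with $|c-1|\le\gamma_0$. For $\lambda>0$ let $$\mathcal A_\lambda=\{r\in W^{1,1}(0,1): r(1)=\lambda,\ r'(R)>0 \text{ for a.e. } R\in(0,1),\ r(0)\ge0\}$$ (where $r$ denotes the continuous representative on $[0,1]$), and for $r\in\mathcal A_\lambda$ define, with values in $(-\infty,\infty]$ and with $\delta(R)=r'(R)\,(r(R)/R)^{n-1}$, $$\hat I(r)=\int_0^1R^{n-1}\Big[\frac{\kappa}{n}\,r'(R)^n+h(\delta(R))+\kappa(n-1)\,\delta(R)\Big(\frac1n+\ln\frac{r(R)}{R}\Big)\Big]\,dR-\frac{\kappa(n-1)}{n}\lambda^n\ln\lambda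 .$$ For $\nu,v>0$ put $$\hat T(\nu,v)=\kappa\Big(\frac{\nu}{v}\Big)^{n-1}+h'(\nu v^{n-1})+(n-1)\kappa\Big(\frac1n+\ln v\Big).$$ Then the equation $\hat T(\bar\lambda,\bar\lambda)=0$ has a unique solution $\bar\lambda>0$, and: 1. if $0<\lambda<\bar\lambda$, then every minimizer $r$ of $\hat I$ over $\mathcal A_\lambda$ is homogeneous, that is, $r(R)=\lambda R$ for all $R\in[0,1]$; 2. if $\lambda$ is sufficiently large (depending only on $n$, $\kappa$ and $h$), then every minimizer $r$ of $\hat I$ over $\mathcal A_\lambda$ is cavitating, that is, $r(0)>0$. -/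

import Mathlib

open MeasureTheory Set Filter Topology
open scoped ENNReal

namespace RadialCavitation

/-- Standing assumptions on the compressibility term `h : (0,∞) → [0,∞)`.  Only the values of `h` on
`(0,∞)` matter.  Since `deriv` is `0` at points of non-differentiability, `deriv_deriv_pos` includes
the existence of the second derivative. -/
structure IsAdmissibleVolumetric (h : ℝ → ℝ) : Prop where
  nonneg : ∀ d, 0 < d → 0 ≤ h d
  contDiffOn : ContDiffOn ℝ 1 h (Ioi 0)
  deriv_deriv_pos : ∀ d, 0 < d → 0 < deriv (deriv h) d
  tendsto_zero : Tendsto h (𝓝[>] 0) atTop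
  tendsto_div : Tendsto (fun d => h d / d) atTop atTop
  deriv_tendsto_zero : Tendsto (deriv h) (𝓝[>] 0) atBot
  deriv_tendsto_atTop : Tendsto (deriv h) atTop atTop

/-- The growth condition `|d h'(c d)| ≤ K (h(d) + 1)` for all `d > 0` and all `c` close to `1`. -/
def DerivGrowth (h : ℝ → ℝ) : Prop :=
  ∃ K > 0, ∃ γ₀ > 0, ∀ d > 0, ∀ c > 0, |c - 1| ≤ γ₀ → |d * deriv h (c * d)| ≤ K * (h d + 1)

/-- The modified stored energy `Φ̂(q, v, …, v)` (one radial stretch `q` and `n - 1` equal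
circumferential stretches `v`):
`(κ/n) qⁿ + h(q vⁿ⁻¹) + κ (n-1) q vⁿ⁻¹ (1/n + ln v)`. -/
noncomputable def modifiedEnergy (n : ℕ) (κ : ℝ) (h : ℝ → ℝ) (q v : ℝ) : ℝ :=
  κ / n * q ^ n + h (q * v ^ (n - 1))
    + κ * ((n : ℝ) - 1) * (q * v ^ (n - 1)) * (1 / n + Real.log v)

/-- The modified radial Cauchy stress `T̂(ν, v) = v¹⁻ⁿ ∂Φ̂/∂v₁ (ν, v, …, v)`. -/
noncomputable def modifiedStress (n : ℕ) (κ : ℝ) (h : ℝ → ℝ) (ν v : ℝ) : ℝ :=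
  deriv (fun q => modifiedEnergy n κ h q v) ν / v ^ (n - 1)

/-- The explicit form of the modified radial Cauchy stress. -/
theorem modifiedStress_eq {n : ℕ} (hn : 1 ≤ n) (κ : ℝ) {h : ℝ → ℝ}
    (hh : ContDiffOn ℝ 1 h (Ioi 0)) {ν v : ℝ} (hν : 0 < ν) (hv : 0 < v) :
    modifiedStress n κ h ν v = κ * (ν / v) ^ (n - 1) + deriv h (ν * v ^ (n - 1))
      + ((n : ℝ) - 1) * κ * (1 / n + Real.log v) := by
  have hp : 0 < v ^ (n - 1) := pow_pos hv _
  have hn0 : (n : ℝ) ≠ 0 := by positivity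
  have hd : HasDerivAt h (deriv h (ν * v ^ (n - 1))) (ν * v ^ (n - 1)) :=
    ((hh.differentiableOn one_ne_zero).differentiableAt (Ioi_mem_nhds (by positivity))).hasDerivAt
  have h1 : HasDerivAt (fun q : ℝ => q * v ^ (n - 1)) (v ^ (n - 1)) ν := by
    simpa using (hasDerivAt_id ν).mul_const (v ^ (n - 1))
  have h2 : HasDerivAt (fun q : ℝ => κ / n * q ^ n) (κ / n * (n * ν ^ (n - 1))) ν :=
    (hasDerivAt_pow n ν).const_mul _
  have h3 := (h2.add (hd.comp ν h1)).add
    ((h1.const_mul (κ * ((n : ℝ) - 1))).mul_const (1 / n + Real.log v))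
  have h4 : deriv (fun q => modifiedEnergy n κ h q v) ν = _ := h3.deriv
  rw [modifiedStress, h4, div_pow]
  field_simp

/-- The integral over `s` with values in `[-∞, ∞]`: integral of the positive part minus integral of
the negative part (meaningful whenever one of the two is finite). -/
noncomputable def extendedIntegral (s : Set ℝ) (f : ℝ → ℝ) : EReal :=
  ((∫⁻ x in s, ENNReal.ofReal (f x) : ℝ≥0∞) : EReal)
    - ((∫⁻ x in s, ENNReal.ofReal (-f x) : ℝ≥0∞) : EReal)

/-- The admissible class `A_lam`: functions `r ∈ W^{1,1}(0,1)` with `r(1) = lam`, `r' > 0` a.e. and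
`r(0) ≥ 0`.  An element of `W^{1,1}(0,1)` is represented by its continuous representative on
`[0,1]`, that is, by an absolutely continuous function, whose weak derivative is its a.e. classical
derivative.  Values of `r` outside `[0,1]` play no role. -/
def admissible (lam : ℝ) : Set (ℝ → ℝ) :=
  {r | AbsolutelyContinuousOnInterval r 0 1 ∧ r 1 = lam ∧
    (∀ᵐ R ∂(volume.restrict (Ioo (0 : ℝ) 1)), 0 < deriv r R) ∧ 0 ≤ r 0}

/-- The modified energy functional
`Î(r) = ∫₀¹ Rⁿ⁻¹ Φ̂(r'(R), r(R)/R, …, r(R)/R) dR - (κ(n-1)/n) lamⁿ ln lam`, with values in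
`(-∞, ∞]` on the class `A_lam`. -/
noncomputable def modifiedFunctional (n : ℕ) (κ : ℝ) (h : ℝ → ℝ) (lam : ℝ) (r : ℝ → ℝ) : EReal :=
  extendedIntegral (Ioo 0 1)
      (fun R => R ^ (n - 1) * modifiedEnergy n κ h (deriv r R) (r R / R))
    - ((κ * ((n : ℝ) - 1) / n * lam ^ n * Real.log lam : ℝ) : EReal)

/-- `r` is a (global) minimizer of `Î` over `A_lam`. -/
def IsMinimizer (n : ℕ) (κ : ℝ) (h : ℝ → ℝ) (lam : ℝ) (r : ℝ → ℝ) : Prop :=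
  r ∈ admissible lam ∧ IsMinOn (modifiedFunctional n κ h lam) (admissible lam) r

end RadialCavitation

/-!
Write `q = r'(R)`, `v = r(R) / R`, `c = r(0)`, and `δ = q vⁿ⁻¹` for the Jacobian of a radial
deformation `r`. The proof compares the energy of `r` directly with that of the homogeneous
deformation `lam * R`; the Euler-Lagrange equation is not used.

The modified energy is `κ` times the `n`-energy `∫ Rⁿ⁻¹ (qⁿ / n + (n - 1) δ (1 / n + ln v))` plus
the volumetric energy `∫ Rⁿ⁻¹ h(δ)`.

* The volumetric part is bounded below by Jensen's inequality: `h` is strictly convex and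
  `∫ Rⁿ⁻¹ δ = (lamⁿ - cⁿ) / n`, because `Rⁿ⁻¹ δ = (rⁿ / n)'`
  (`integral_volumetricDensity_ge`). Equality with `c = 0` holds only for the homogeneous
  deformation (`eq_mul_of_integral_volumetricDensity_le`).
* The `n`-energy is bounded below by a calibration (`integral_dirichletDensity_ge`). Regarding `R`
  as a function of `r`, the energy can be minimized pointwise among the deformations with cavity
  radius `c`, and the minimum is attained where `R q = (rⁿ - cⁿ)^(1 / n)`. Young's inequality
  with this slope makes all terms that depend on `v` combine into the exact derivative of
  `(rⁿ - cⁿ) ln v`, and bounding the remaining fractional power from below by a polynomial in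
  `cⁿ / rⁿ` gives a lower bound that is an exact derivative as well (`calibration_le`). The boundary
  term `(rⁿ - cⁿ) ln v` vanishes at the origin because a finite energy makes `rⁿ⁻¹ r' ln (1 / R)`
  integrable (`tendsto_pow_sub_mul_log`).

Added up, the energy of `r` is at least the energy of `lam * R`, minus `(cⁿ / n) T̂(lam, lam)`, plus
a remainder that is positive when `c > 0` (`energy_ge`). For `lam < lamBar` the stress
`T̂(lam, lam)` is negative, so a minimizer has `c = 0` and equality holds in Jensen's inequality.

For every `lam`, a deformation with `c = 0` has at least the energy of `lam * R`. For large `lam`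
the latter exceeds the energy of the deformation that opens a cavity with `cⁿ = lamⁿ / 2` and has
constant Jacobian (`modifiedFunctional_cavity_le`), so a minimizer has `c > 0`.
-/

namespace RadialCavitation

/-! ### Absolutely continuous functions -/

theorem absolutelyContinuousOnInterval_comp_of_contDiffOn {f g : ℝ → ℝ} {a b m M : ℝ}
    (hg : ContDiffOn ℝ 1 g (Icc m M)) (hf : AbsolutelyContinuousOnInterval f a b)
    (hfm : MapsTo f (uIcc a b) (Icc m M)) :
    AbsolutelyContinuousOnInterval (fun x => g (f x)) a b := by
  obtain ⟨K, hK⟩ := hg.exists_lipschitzOnWith (by decide) (convex_Icc _ _) isCompact_Icc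
  unfold AbsolutelyContinuousOnInterval at hf ⊢
  refine squeeze_zero' (Eventually.of_forall fun E => Finset.sum_nonneg fun i _ => dist_nonneg)
    ?_ (by simpa using hf.const_mul (K : ℝ))
  have hE : ∀ᶠ E : ℕ × (ℕ → ℝ × ℝ) in AbsolutelyContinuousOnInterval.totalLengthFilter ⊓
      𝓟 (AbsolutelyContinuousOnInterval.disjWithin a b),
      E ∈ AbsolutelyContinuousOnInterval.disjWithin a b :=
    eventually_inf_principal.2 (Eventually.of_forall fun _ h => h)
  filter_upwards [hE] with E hE
  rw [Finset.mul_sum]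
  refine Finset.sum_le_sum fun i hi => ?_
  have := hE.1 i hi
  exact hK.dist_le_mul _ (hfm this.1) _ (hfm this.2)

/-- The fundamental theorem of calculus for an absolutely continuous function whose derivative is
known almost everywhere. -/
theorem integral_eq_sub_of_absolutelyContinuousOnInterval {B B' : ℝ → ℝ} {a b : ℝ}
    (hB : AbsolutelyContinuousOnInterval B a b)
    (hd : ∀ᵐ x, x ∈ uIoc a b → HasDerivAt B (B' x) x) :
    IntervalIntegrable B' volume a b ∧ ∫ x in a..b, B' x = B b - B a := by
  have he : ∀ᵐ x, x ∈ uIoc a b → deriv B x = B' x := by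
    filter_upwards [hd] with x hx hm using (hx hm).deriv
  refine ⟨hB.intervalIntegrable_deriv.congr_ae ?_, ?_⟩
  · exact (ae_restrict_iff' measurableSet_uIoc).2 he
  · rw [← hB.integral_deriv_eq_sub]
    refine intervalIntegral.integral_congr_ae ?_
    filter_upwards [he] with x hx hm using (hx hm).symm

/-! ### Elementary inequalities -/

/-- Young's inequality with exponents `n` and `n / (n - 1)`, in a form without roots. -/
theorem natCast_mul_pow_mul_le {n : ℕ} (hn : 1 ≤ n) {s t : ℝ} (hs : 0 ≤ s) (ht : 0 ≤ t) :
    n * (t ^ (n - 1) * s) ≤ s ^ n + ((n : ℝ) - 1) * t ^ n := by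
  obtain ⟨m, rfl⟩ : ∃ m, n = m + 1 := ⟨n - 1, by omega⟩
  rcases ht.eq_or_lt with rfl | ht
  · rcases Nat.eq_zero_or_pos m with rfl | hm
    · simp
    · simp [hm.ne']; positivity
  · have := one_add_mul_le_pow (a := s / t - 1) (by have := div_nonneg hs ht.le; linarith) (m + 1)
    have h2 := mul_le_mul_of_nonneg_right this (pow_pos ht (m + 1)).le
    rw [add_sub_cancel, div_pow, div_mul_cancel₀ _ (pow_pos ht _).ne'] at h2
    have h3 : (1 + ((m + 1 : ℕ) : ℝ) * (s / t - 1)) * t ^ (m + 1)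
        = ((m + 1 : ℕ) : ℝ) * (t ^ m * s) - (((m + 1 : ℕ) : ℝ) - 1) * t ^ (m + 1) := by
      rw [pow_succ]; field_simp; ring
    rw [h3] at h2
    simp only [Nat.add_sub_cancel]
    linarith

/-- Up to the factor `1 + y / n`, this is Young's inequality for `s` and `(1 - y) ^ (1 / n)`; the
factor is a polynomial lower bound for `(1 - y) ^ (-1 / n)`. -/
theorem mul_one_sub_mul_le {n : ℕ} (hn : 1 ≤ n) {s y : ℝ} (hs : 0 ≤ s) (hy : 0 ≤ y) (hy1 : y ≤ 1) :
    n * (s * ((1 - y) * (1 + y / n))) ≤ s ^ n + ((n : ℝ) - 1) * (1 - y) := by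
  have hn0 : (0 : ℝ) < n := by exact_mod_cast hn
  have hn1 : (1 : ℝ) ≤ n := by exact_mod_cast hn
  have hz : 0 ≤ 1 - y := by linarith
  set t : ℝ := (1 - y) ^ ((n : ℝ)⁻¹) with ht
  have ht0 : 0 ≤ t := Real.rpow_nonneg hz _
  have htn : t ^ n = 1 - y := Real.rpow_inv_natCast_pow hz (by omega)
  have htle : t ≤ 1 - y / n := by
    have := rpow_one_add_le_one_add_mul_self (s := -y) (by linarith) (p := (n : ℝ)⁻¹)
      (by positivity) (inv_le_one_of_one_le₀ hn1)
    rw [← sub_eq_add_neg] at this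
    refine this.trans (le_of_eq ?_)
    ring
  have hyn : 0 ≤ y / n := by positivity
  -- Bernoulli: `(1 - y) ^ (1 / n) ≤ 1 - y / n ≤ (1 + y / n)⁻¹`.
  have hprod : t * (1 + y / n) ≤ 1 := by nlinarith
  have hpow : (1 - y) * (1 + y / n) ≤ t ^ (n - 1) := by
    calc (1 - y) * (1 + y / n) = t ^ (n - 1) * (t * (1 + y / n)) := by
          rw [← htn, ← pow_sub_one_mul (by omega : n ≠ 0) t]; ring
      _ ≤ t ^ (n - 1) * 1 := by gcongr
      _ = _ := mul_one _
  have hY := natCast_mul_pow_mul_le hn hs ht0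
  rw [htn] at hY
  refine le_trans ?_ hY
  rw [mul_comm s]
  gcongr

/-- The calibration inequality, at a radius `R` where `r = x`, `r' = q` and `r(0) = c`. The left side
is the derivative of `rⁿ / n + c²ⁿ / (n² rⁿ) + ((n - 1) / n) (rⁿ - cⁿ) ln (r / R)`; the logarithms on
both sides cancel, and what remains is `mul_one_sub_mul_le` for `s = q R / x` and
`y = cⁿ / xⁿ`. -/
theorem calibration_le {n : ℕ} (hn : 1 ≤ n) {q x R c : ℝ} (hq : 0 ≤ q) (hx : 0 < x) (hR : 0 < R)
    (hc : 0 ≤ c) (hcx : c ≤ x) :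
    q * (x ^ (n - 1) - c ^ (2 * n) / (n * x ^ (n + 1)))
        + ((n : ℝ) - 1) / n * (n * x ^ (n - 1) * q * (Real.log x - Real.log R)
            + (x ^ n - c ^ n) * (q / x - 1 / R))
      ≤ R ^ (n - 1) * (q ^ n / n
          + ((n : ℝ) - 1) * (q * (x / R) ^ (n - 1)) * (1 / n + Real.log (x / R))) := by
  have hn0 : (0 : ℝ) < n := by exact_mod_cast hn
  have hy1 : c ^ n / x ^ n ≤ 1 := (div_le_one (by positivity)).2 (by gcongr)
  have key := mul_one_sub_mul_le hn (s := q * R / x) (y := c ^ n / x ^ n) (by positivity)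
    (by positivity) hy1
  have key2 := mul_le_mul_of_nonneg_left key (show 0 ≤ x ^ n / (n * R) by positivity)
  rw [Real.log_div hx.ne' hR.ne']
  obtain ⟨m, rfl⟩ : ∃ m, n = m + 1 := ⟨n - 1, by omega⟩
  simp only [Nat.add_sub_cancel] at *
  rw [← sub_nonneg] at key2 ⊢
  refine key2.trans (le_of_eq ?_)
  generalize Real.log x - Real.log R = L
  rw [two_mul, pow_add c, div_pow, div_pow, mul_pow]
  generalize hC : c ^ (m + 1) = C
  simp only [pow_succ]
  field_simp
  ring

/-! ### Admissible deformations -/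

section Admissible

variable {lam : ℝ} {r : ℝ → ℝ}

theorem admissible.continuousOn (hr : r ∈ admissible lam) : ContinuousOn r (Icc 0 1) := by
  simpa using hr.1.continuousOn

theorem admissible.absolutelyContinuousOnInterval (hr : r ∈ admissible lam) {a b : ℝ}
    (ha : 0 ≤ a) (hab : a ≤ b) (hb : b ≤ 1) : AbsolutelyContinuousOnInterval r a b := by
  refine hr.1.mono ?_
  rw [uIcc_of_le hab, uIcc_of_le zero_le_one]
  exact Icc_subset_Icc ha hb

theorem admissible.ae_hasDerivAt (hr : r ∈ admissible lam) :
    ∀ᵐ R, R ∈ Ioo (0 : ℝ) 1 → HasDerivAt r (deriv r R) R ∧ 0 < deriv r R := by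
  filter_upwards [hr.1.ae_differentiableAt, (ae_restrict_iff' measurableSet_Ioo).1 hr.2.2.1]
    with R h1 h2 hR
  refine ⟨(h1 ?_).hasDerivAt, h2 hR⟩
  rw [uIcc_of_le zero_le_one]
  exact Ioo_subset_Icc_self hR

theorem admissible.integrableOn_deriv (hr : r ∈ admissible lam) :
    IntegrableOn (deriv r) (Ioo 0 1) := by
  have := hr.1.intervalIntegrable_deriv
  rw [intervalIntegrable_iff_integrableOn_Ioo_of_le zero_le_one] at this
  exact this

theorem admissible.monotoneOn (hr : r ∈ admissible lam) : MonotoneOn r (Icc 0 1) := by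
  intro a ha b hb hab
  have h := (admissible.absolutelyContinuousOnInterval hr ha.1 hab hb.2).integral_deriv_eq_sub
  have h2 : 0 ≤ ∫ x in a..b, deriv r x := by
    refine intervalIntegral.integral_nonneg_of_ae_restrict hab ?_
    have : ∀ᵐ x ∂volume.restrict (Ioo a b), 0 ≤ deriv r x := by
      refine (ae_restrict_iff' measurableSet_Ioo).2 ?_
      filter_upwards [admissible.ae_hasDerivAt hr] with x hx hm
      exact (hx (Ioo_subset_Ioo ha.1 hb.2 hm)).2.le
    rwa [Measure.restrict_congr_set Ioo_ae_eq_Icc] at this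
  linarith

theorem admissible.strictMonoOn (hr : r ∈ admissible lam) : StrictMonoOn r (Icc 0 1) := by
  intro a ha b hb hab
  refine (admissible.monotoneOn hr ha hb hab.le).lt_of_ne fun heq => ?_
  have hae : ∀ᵐ R, R ∉ Ioo a b := by
    filter_upwards [admissible.ae_hasDerivAt hr] with R hR hm
    -- Equal end values would make the monotone function `r` constant, with zero derivative.
    have hc : r =ᶠ[𝓝 R] fun _ => r a := by
      filter_upwards [Ioo_mem_nhds hm.1 hm.2] with x hx
      have hx' : x ∈ Icc (0 : ℝ) 1 := ⟨ha.1.trans hx.1.le, hx.2.le.trans hb.2⟩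
      exact le_antisymm ((admissible.monotoneOn hr hx' hb hx.2.le).trans heq.ge)
        (admissible.monotoneOn hr ha hx' hx.1.le)
    have := (hR (Ioo_subset_Ioo ha.1 hb.2 hm)).2
    rw [hc.deriv_eq, deriv_const] at this
    exact this.false
  have h0 : volume (Ioo a b) = 0 := by
    simpa only [ae_iff, not_not] using! hae
  rw [Real.volume_Ioo, ENNReal.ofReal_eq_zero] at h0
  linarith

theorem admissible.pos (hr : r ∈ admissible lam) {R : ℝ} (hR : 0 < R) (hR1 : R ≤ 1) : 0 < r R :=
  hr.2.2.2.trans_lt (admissible.strictMonoOn hr ⟨le_rfl, zero_le_one⟩ ⟨hR.le, hR1⟩ hR)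

theorem admissible.zero_le (hr : r ∈ admissible lam) {R : ℝ} (hR : 0 ≤ R) (hR1 : R ≤ 1) :
    r 0 ≤ r R := admissible.monotoneOn hr ⟨le_rfl, zero_le_one⟩ ⟨hR, hR1⟩ hR

theorem admissible.le (hr : r ∈ admissible lam) {R : ℝ} (hR : 0 ≤ R) (hR1 : R ≤ 1) :
    r R ≤ lam := (admissible.monotoneOn hr ⟨hR, hR1⟩ ⟨zero_le_one, le_rfl⟩ hR1).trans hr.2.1.le

/-- `rⁿ⁻¹ r'` is the derivative of `rⁿ / n`. -/
theorem admissible.integral_pow_mul_deriv (hr : r ∈ admissible lam) {n : ℕ} (hn : 1 ≤ n) {a b : ℝ}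
    (ha : 0 ≤ a) (hab : a ≤ b) (hb : b ≤ 1) :
    IntervalIntegrable (fun R => r R ^ (n - 1) * deriv r R) volume a b ∧
      ∫ R in a..b, r R ^ (n - 1) * deriv r R = (r b ^ n - r a ^ n) / n := by
  have hn0 : (0 : ℝ) < n := by exact_mod_cast hn
  rw [sub_div]
  have hAC := absolutelyContinuousOnInterval_comp_of_contDiffOn (g := fun x => x ^ n / n)
    (m := 0) (M := lam) (by fun_prop) (admissible.absolutelyContinuousOnInterval hr ha hab hb) (by
      intro x hx
      rw [uIcc_of_le hab] at hx
      exact ⟨hr.2.2.2.trans (admissible.zero_le hr (ha.trans hx.1) (hx.2.trans hb)),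
        admissible.le hr (ha.trans hx.1) (hx.2.trans hb)⟩)
  refine integral_eq_sub_of_absolutelyContinuousOnInterval hAC ?_
  filter_upwards [admissible.ae_hasDerivAt hr, compl_mem_ae_iff.2 (measure_singleton (1 : ℝ))]
    with x hx h1 hm
  rw [uIoc_of_le hab] at hm
  have hd := (hx ⟨ha.trans_lt hm.1, (hm.2.trans hb).lt_of_ne h1⟩).1
  refine ((hd.pow n).div_const (n : ℝ)).congr_deriv ?_
  field_simp

theorem admissible.aemeasurable (hr : r ∈ admissible lam) :
    AEMeasurable r (volume.restrict (Ioo 0 1)) :=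
  ((admissible.continuousOn hr).mono Ioo_subset_Icc_self).aemeasurable measurableSet_Ioo

end Admissible

/-! ### The `n`-energy -/

/-- The integrand `Rⁿ⁻¹ (qⁿ / n + (n - 1) q vⁿ⁻¹ (1 / n + ln v))`, with `q = r'(R)` and
`v = r(R) / R`: the part of the modified energy that does not involve `h`, divided by `κ`. -/
noncomputable def dirichletDensity (n : ℕ) (r : ℝ → ℝ) (R : ℝ) : ℝ :=
  R ^ (n - 1) * (deriv r R ^ n / n
    + ((n : ℝ) - 1) * (deriv r R * (r R / R) ^ (n - 1)) * (1 / n + Real.log (r R / R)))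

/-- The primitive of the lower bound in `calibration_le`, as a function of the radius. The middle
term is `0` for `r 0 = 0`, also at `R = 0` where it reads `0 / 0`. -/
noncomputable def calibration (n : ℕ) (r : ℝ → ℝ) (R : ℝ) : ℝ :=
  r R ^ n / n + r 0 ^ (2 * n) / (n ^ 2 * r R ^ n)
    + ((n : ℝ) - 1) / n * ((r R ^ n - r 0 ^ n) * (Real.log (r R) - Real.log R))

section Dirichlet

variable {lam : ℝ} {r : ℝ → ℝ} {n : ℕ}

theorem calibration_sub_le_integral (hn : 1 ≤ n) (hr : r ∈ admissible lam)
    (hj : IntegrableOn (dirichletDensity n r) (Ioo 0 1)) {ε : ℝ} (hε : 0 < ε) (hε1 : ε ≤ 1) :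
    calibration n r 1 - calibration n r ε ≤ ∫ R in ε..1, dirichletDensity n r R := by
  have hn0 : (0 : ℝ) < n := by exact_mod_cast hn
  have hrε := admissible.pos hr hε hε1
  have hAC := admissible.absolutelyContinuousOnInterval hr hε.le hε1 le_rfl
  have hmaps : MapsTo r (uIcc ε 1) (Icc (r ε) lam) := by
    intro x hx
    rw [uIcc_of_le hε1] at hx
    exact ⟨admissible.monotoneOn hr ⟨hε.le, hε1⟩ ⟨hε.le.trans hx.1, hx.2⟩ hx.1,
      admissible.le hr (hε.le.trans hx.1) hx.2⟩
  have hpos : ∀ x ∈ Icc (r ε) lam, x ≠ 0 := fun x hx => (hrε.trans_le hx.1).ne'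
  have h1 := absolutelyContinuousOnInterval_comp_of_contDiffOn
    (g := fun x => x ^ n / n + r 0 ^ (2 * n) / (n ^ 2 * x ^ n)) (m := r ε) (M := lam)
    (by
      refine ContDiffOn.add (by fun_prop) (ContDiffOn.div (by fun_prop) (by fun_prop) ?_)
      intro x hx
      have := hpos x hx
      positivity) hAC hmaps
  have h2 := absolutelyContinuousOnInterval_comp_of_contDiffOn
    (g := fun x => x ^ n - r 0 ^ n) (m := r ε) (M := lam) (by fun_prop) hAC hmaps
  have h3 := absolutelyContinuousOnInterval_comp_of_contDiffOn
    (g := Real.log) (m := r ε) (M := lam)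
    (fun x hx => (Real.contDiffAt_log.2 (hpos x hx)).contDiffWithinAt) hAC hmaps
  have h4 : AbsolutelyContinuousOnInterval Real.log ε 1 :=
    ContDiffOn.absolutelyContinuousOnInterval fun x hx => by
      rw [uIcc_of_le hε1] at hx
      exact (Real.contDiffAt_log.2 (hε.trans_le hx.1).ne').contDiffWithinAt
  have hB : AbsolutelyContinuousOnInterval (calibration n r) ε 1 :=
    h1.add ((h2.mul (h3.sub h4)).const_mul (((n : ℝ) - 1) / n))
  obtain ⟨hI, hE⟩ := integral_eq_sub_of_absolutelyContinuousOnInterval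
    (B' := fun R => deriv r R * (r R ^ (n - 1) - r 0 ^ (2 * n) / (n * r R ^ (n + 1)))
        + ((n : ℝ) - 1) / n * (n * r R ^ (n - 1) * deriv r R * (Real.log (r R) - Real.log R)
            + (r R ^ n - r 0 ^ n) * (deriv r R / r R - 1 / R))) hB (by
      filter_upwards [admissible.ae_hasDerivAt hr, compl_mem_ae_iff.2 (measure_singleton (1 : ℝ))]
        with x hx hx1 hm
      rw [uIoc_of_le hε1] at hm
      have hx0 : 0 < x := hε.trans hm.1
      have hd := (hx ⟨hx0, hm.2.lt_of_ne hx1⟩).1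
      have hrx := admissible.pos hr hx0 hm.2
      have hd1 := (hd.pow n).div_const (n : ℝ)
      have hd2 := (hasDerivAt_const x (r 0 ^ (2 * n))).div ((hd.pow n).const_mul ((n : ℝ) ^ 2))
        (by simp only [Pi.pow_apply]; positivity)
      have hd3 := ((hd.pow n).sub_const (r 0 ^ n)).mul
        ((hd.log hrx.ne').sub (Real.hasDerivAt_log hx0.ne'))
      refine ((hd1.add hd2).add (hd3.const_mul (((n : ℝ) - 1) / n))).congr_deriv ?_
      obtain ⟨m, rfl⟩ : ∃ m, n = m + 1 := ⟨n - 1, by omega⟩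
      simp only [Nat.add_sub_cancel, Pi.pow_apply, Pi.sub_apply]
      generalize Real.log (r x) - Real.log x = L
      simp only [pow_succ, two_mul, pow_add]
      field_simp
      ring)
  rw [← hE]
  have hj' : IntervalIntegrable (dirichletDensity n r) volume ε 1 := by
    rw [intervalIntegrable_iff_integrableOn_Ioo_of_le hε1]
    exact hj.mono_set (Ioo_subset_Ioo_left hε.le)
  refine intervalIntegral.integral_mono_ae_restrict hε1 hI hj' ?_
  rw [← Measure.restrict_congr_set Ioo_ae_eq_Icc]
  refine (ae_restrict_iff' measurableSet_Ioo).2 ?_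
  filter_upwards [admissible.ae_hasDerivAt hr] with x hx hm
  have hx0 : 0 < x := hε.trans hm.1
  exact calibration_le hn (hx ⟨hx0, hm.2⟩).2.le (admissible.pos hr hx0 hm.2.le) hx0 hr.2.2.2
    (admissible.zero_le hr hx0.le hm.2.le)

/-- The constant in the lower bound for the `n`-energy comes from `xⁿ⁻¹ ln x ≥ -xⁿ⁻²`. -/
theorem dirichletDensity_ge (hn : 2 ≤ n) {R : ℝ} (hR : 0 < R) (hr : 0 < r R) (hrl : r R ≤ lam)
    (hq : 0 < deriv r R) :
    ((n : ℝ) - 1) * (r R ^ (n - 1) * deriv r R * -Real.log R)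
      ≤ dirichletDensity n r R + ((n : ℝ) - 1) * lam ^ (n - 2) * deriv r R := by
  have hn2 : (2 : ℝ) ≤ n := by exact_mod_cast hn
  have hlog : -lam ^ (n - 2) ≤ r R ^ (n - 1) * Real.log (r R) := by
    -- `ln x ≥ 1 - 1 / x`; dropping the `1` leaves a bound of the right degree.
    have h1 := Real.one_sub_inv_le_log_of_pos hr
    have h2 : -(r R)⁻¹ ≤ Real.log (r R) := by linarith
    calc -lam ^ (n - 2) ≤ -r R ^ (n - 2) := by gcongr
      _ = r R ^ (n - 1) * -(r R)⁻¹ := by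
        rw [show n - 1 = (n - 2) + 1 by omega, pow_succ]; field_simp
      _ ≤ _ := by gcongr
  have hdef : dirichletDensity n r R = R ^ (n - 1) * (deriv r R ^ n / n)
      + ((n : ℝ) - 1) * (r R ^ (n - 1) * deriv r R) * (1 / n)
      + ((n : ℝ) - 1) * (r R ^ (n - 1) * Real.log (r R) * deriv r R)
      + ((n : ℝ) - 1) * (r R ^ (n - 1) * deriv r R * -Real.log R) := by
    rw [dirichletDensity, Real.log_div hr.ne' hR.ne', div_pow]
    field_simp
    ring
  have h3 : -lam ^ (n - 2) * deriv r R ≤ r R ^ (n - 1) * Real.log (r R) * deriv r R := by gcongr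
  have hn1 : 0 ≤ (n : ℝ) - 1 := by linarith
  have h4 := mul_le_mul_of_nonneg_left h3 hn1
  have h5 : 0 ≤ R ^ (n - 1) * (deriv r R ^ n / n) := by positivity
  have h6 : 0 ≤ ((n : ℝ) - 1) * (r R ^ (n - 1) * deriv r R) * (1 / n) := by positivity
  rw [hdef]
  linarith

theorem neg_le_dirichletDensity (hn : 2 ≤ n) {R : ℝ} (hR : 0 < R) (hR1 : R ≤ 1) (hr : 0 < r R)
    (hrl : r R ≤ lam) (hq : 0 < deriv r R) :
    -(((n : ℝ) - 1) * lam ^ (n - 2) * deriv r R) ≤ dirichletDensity n r R := by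
  have h := dirichletDensity_ge hn hR hr hrl hq
  have hn2 : (2 : ℝ) ≤ n := by exact_mod_cast hn
  have hn1 : 0 ≤ (n : ℝ) - 1 := by linarith
  have hl : 0 ≤ -Real.log R := by have := Real.log_nonpos hR.le hR1; linarith
  have : 0 ≤ ((n : ℝ) - 1) * (r R ^ (n - 1) * deriv r R * -Real.log R) := by positivity
  linarith

/-- Finite energy forces the logarithmic singularity at the origin to be harmless:
`rⁿ⁻¹ r' ln (1 / R)` is integrable, which bounds `(rⁿ - r(0)ⁿ) ln (1 / R)` by the tail of a
convergent integral. -/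
theorem tendsto_pow_sub_mul_log (hn : 2 ≤ n) (hr : r ∈ admissible lam)
    (hj : IntegrableOn (dirichletDensity n r) (Ioo 0 1)) :
    Tendsto (fun R => (r R ^ n - r 0 ^ n) * Real.log R) (𝓝[>] 0) (𝓝 0) := by
  have hn2 : (2 : ℝ) ≤ n := by exact_mod_cast hn
  have hn1 : 0 < (n : ℝ) - 1 := by linarith
  set g : ℝ → ℝ := fun R => r R ^ (n - 1) * deriv r R * -Real.log R with hg
  have hgm : AEStronglyMeasurable g (volume.restrict (Ioo 0 1)) :=
    ((((admissible.aemeasurable hr).pow_const _).mul (measurable_deriv r).aemeasurable).mul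
      Real.measurable_log.neg.aemeasurable).aestronglyMeasurable
  have hgi : IntegrableOn g (Ioo 0 1) := by
    refine Integrable.mono' ((hj.add ((admissible.integrableOn_deriv hr).const_mul
      (((n : ℝ) - 1) * lam ^ (n - 2)))).const_mul ((n : ℝ) - 1)⁻¹) hgm ?_
    refine (ae_restrict_iff' measurableSet_Ioo).2 ?_
    filter_upwards [admissible.ae_hasDerivAt hr] with R hR hm
    have hrp := admissible.pos hr hm.1 hm.2.le
    have hq := (hR hm).2
    have hl : 0 ≤ -Real.log R := by have := Real.log_nonpos hm.1.le hm.2.le; linarith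
    have h := dirichletDensity_ge hn hm.1 hrp (admissible.le hr hm.1.le hm.2.le) hq
    rw [Real.norm_of_nonneg (by positivity)]
    simp only [Pi.add_apply]
    rw [← div_eq_inv_mul, le_div_iff₀ hn1, mul_comm]
    exact h
  have hgI : IntervalIntegrable g volume 0 1 := by
    rwa [intervalIntegrable_iff_integrableOn_Ioo_of_le zero_le_one]
  have hlim : Tendsto (fun ε => ∫ R in (0 : ℝ)..ε, g R) (𝓝[>] 0) (𝓝 0) := by
    have hc := intervalIntegral.continuousOn_primitive_interval'
      (a := (0 : ℝ)) hgI left_mem_uIcc 0 left_mem_uIcc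
    rw [ContinuousWithinAt, intervalIntegral.integral_same, uIcc_of_le zero_le_one] at hc
    refine hc.mono_left ?_
    rw [← nhdsWithin_Ioc_eq_nhdsGT (zero_lt_one (α := ℝ))]
    exact nhdsWithin_mono _ Ioc_subset_Icc_self
  have hlim2 : Tendsto (fun ε => -(n * ∫ R in (0 : ℝ)..ε, g R)) (𝓝[>] 0) (𝓝 0) := by
    simpa using (hlim.const_mul (n : ℝ)).neg
  have hmem : ∀ᶠ ε : ℝ in 𝓝[>] 0, ε ∈ Ioc (0 : ℝ) 1 := Ioc_mem_nhdsGT zero_lt_one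
  refine tendsto_of_tendsto_of_tendsto_of_le_of_le' hlim2 tendsto_const_nhds ?_ ?_
  · -- `ln (1 / ε) ≤ ln (1 / R)` under the integral `∫₀^ε rⁿ⁻¹ r' = (r(ε)ⁿ - r(0)ⁿ) / n`.
    filter_upwards [hmem] with ε hε
    obtain ⟨hI, hE⟩ := admissible.integral_pow_mul_deriv hr (by omega : 1 ≤ n) le_rfl hε.1.le hε.2
    have hmono : ∫ R in (0 : ℝ)..ε, r R ^ (n - 1) * deriv r R * -Real.log ε
        ≤ ∫ R in (0 : ℝ)..ε, g R := by
      refine intervalIntegral.integral_mono_ae_restrict hε.1.le (hI.mul_const _)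
        (hgI.mono_set (by
          rw [uIcc_of_le hε.1.le, uIcc_of_le zero_le_one]; exact Icc_subset_Icc_right hε.2)) ?_
      rw [← Measure.restrict_congr_set Ioo_ae_eq_Icc]
      refine (ae_restrict_iff' measurableSet_Ioo).2 ?_
      filter_upwards [admissible.ae_hasDerivAt hr] with R hR hm
      have hR1 : R < 1 := hm.2.trans_le hε.2
      have hq := (hR ⟨hm.1, hR1⟩).2
      have hrp := admissible.pos hr hm.1 hR1.le
      have hlog : Real.log R ≤ Real.log ε := Real.log_le_log hm.1 hm.2.le
      simp only [hg]
      gcongr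
    rw [intervalIntegral.integral_mul_const, hE] at hmono
    have hn0 : (0 : ℝ) < n := by linarith
    have := mul_le_mul_of_nonneg_left hmono hn0.le
    rw [← mul_assoc, mul_div_cancel₀ _ hn0.ne'] at this
    linarith
  · filter_upwards [hmem] with ε hε
    refine mul_nonpos_of_nonneg_of_nonpos ?_ (Real.log_nonpos hε.1.le hε.2)
    have := admissible.zero_le hr hε.1.le hε.2
    have h0 := hr.2.2.2
    rw [sub_nonneg]
    gcongr

theorem admissible.tendsto_nhdsGT (hr : r ∈ admissible lam) :
    Tendsto r (𝓝[>] 0) (𝓝 (r 0)) := by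
  have := admissible.continuousOn hr 0 ⟨le_rfl, zero_le_one⟩
  refine this.mono_left ?_
  rw [← nhdsWithin_Ioc_eq_nhdsGT (zero_lt_one (α := ℝ))]
  exact nhdsWithin_mono _ Ioc_subset_Icc_self

theorem tendsto_calibration (hn : 2 ≤ n) (hr : r ∈ admissible lam)
    (hj : IntegrableOn (dirichletDensity n r) (Ioo 0 1)) :
    Tendsto (calibration n r) (𝓝[>] 0) (𝓝 (r 0 ^ n * (n + 1) / n ^ 2)) := by
  have hn2 : (2 : ℝ) ≤ n := by exact_mod_cast hn
  have hr0 := admissible.tendsto_nhdsGT hr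
  have h1 := hr0.pow n |>.div_const (n : ℝ)
  have h2 : Tendsto (fun R => r 0 ^ (2 * n) / (n ^ 2 * r R ^ n)) (𝓝[>] 0)
      (𝓝 (r 0 ^ n / n ^ 2)) := by
    rcases hr.2.2.2.eq_or_lt with h0 | h0
    · simp [← h0, show n ≠ 0 by omega]
    · have : r 0 ^ n / n ^ 2 = r 0 ^ (2 * n) / (n ^ 2 * r 0 ^ n) := by
        rw [two_mul, pow_add, mul_comm, mul_div_mul_right _ _ (by positivity)]
      rw [this]
      exact tendsto_const_nhds.div ((hr0.pow n).const_mul _) (by positivity)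
  have h3 : Tendsto (fun R => (r R ^ n - r 0 ^ n) * Real.log (r R)) (𝓝[>] 0) (𝓝 0) := by
    rcases hr.2.2.2.eq_or_lt with h0 | h0
    · have hc : Continuous fun x : ℝ => x ^ (n - 1) * (x * Real.log x) :=
        (continuous_pow _).mul Real.continuous_mul_log
      have := (hc.tendsto (r 0)).comp hr0
      rw [← h0] at this ⊢
      simp only [zero_mul, mul_zero] at this
      refine this.congr fun x => ?_
      simp only [Function.comp, zero_pow (by omega : n ≠ 0), sub_zero]
      rw [← mul_assoc, pow_sub_one_mul (by omega)]
    · have := (hr0.pow n |>.sub_const (r 0 ^ n)).mul (hr0.log h0.ne')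
      simpa using this
  have h4 := tendsto_pow_sub_mul_log hn hr hj
  have h5 := (h1.add h2).add ((h3.sub h4).const_mul (((n : ℝ) - 1) / n))
  convert h5 using 2
  · rw [calibration]; ring
  · field_simp; ring

/-- The lower bound for the `n`-energy in terms of the cavity radius `r 0`; equality holds for the
homogeneous deformation. -/
theorem integral_dirichletDensity_ge (hn : 2 ≤ n) (hr : r ∈ admissible lam)
    (hj : IntegrableOn (dirichletDensity n r) (Ioo 0 1)) :
    lam ^ n / n + r 0 ^ (2 * n) / (n ^ 2 * lam ^ n) - r 0 ^ n * (n + 1) / n ^ 2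
        + ((n : ℝ) - 1) / n * ((lam ^ n - r 0 ^ n) * Real.log lam)
      ≤ ∫ R in Ioo 0 1, dirichletDensity n r R := by
  have hjI : IntervalIntegrable (dirichletDensity n r) volume 0 1 := by
    rwa [intervalIntegrable_iff_integrableOn_Ioo_of_le zero_le_one]
  have hlim : Tendsto (fun ε => ∫ R in ε..1, dirichletDensity n r R) (𝓝[>] 0)
      (𝓝 (∫ R in (0 : ℝ)..1, dirichletDensity n r R)) := by
    have hc := intervalIntegral.continuousOn_primitive_interval_left
      (μ := volume) (f := dirichletDensity n r) (a := (0 : ℝ)) (b := 1) (by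
        rw [uIcc_of_le zero_le_one, integrableOn_Icc_iff_integrableOn_Ioo]; exact hj)
      0 left_mem_uIcc
    rw [uIcc_of_le zero_le_one] at hc
    refine hc.mono_left ?_
    rw [← nhdsWithin_Ioc_eq_nhdsGT (zero_lt_one (α := ℝ))]
    exact nhdsWithin_mono _ Ioc_subset_Icc_self
  have hle := le_of_tendsto_of_tendsto
    ((tendsto_const_nhds (x := calibration n r 1)).sub (tendsto_calibration hn hr hj)) hlim (by
      filter_upwards [Ioc_mem_nhdsGT (zero_lt_one (α := ℝ))] with ε hε
      exact calibration_sub_le_integral (by omega) hr hj hε.1 hε.2)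
  rw [intervalIntegral.integral_of_le zero_le_one, integral_Ioc_eq_integral_Ioo] at hle
  refine le_trans (le_of_eq ?_) hle
  rw [calibration, hr.2.1, Real.log_one]
  ring

end Dirichlet

/-! ### The compressibility term -/

section Volumetric

variable {h : ℝ → ℝ}

theorem IsAdmissibleVolumetric.strictConvexOn (hh : IsAdmissibleVolumetric h) :
    StrictConvexOn ℝ (Ioi 0) h :=
  strictConvexOn_of_deriv2_pos (convex_Ioi 0) hh.contDiffOn.continuousOn fun x hx => by
    rw [interior_Ioi] at hx
    exact hh.deriv_deriv_pos x hx

theorem IsAdmissibleVolumetric.continuousOn_deriv (hh : IsAdmissibleVolumetric h) :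
    ContinuousOn (deriv h) (Ioi 0) :=
  hh.contDiffOn.continuousOn_deriv_of_isOpen isOpen_Ioi le_rfl

theorem IsAdmissibleVolumetric.strictMonoOn_deriv (hh : IsAdmissibleVolumetric h) :
    StrictMonoOn (deriv h) (Ioi 0) :=
  strictMonoOn_of_deriv_pos (convex_Ioi 0) hh.continuousOn_deriv fun x hx => by
    rw [interior_Ioi] at hx
    exact hh.deriv_deriv_pos x hx

theorem IsAdmissibleVolumetric.tangent_lt (hh : IsAdmissibleVolumetric h) {d m : ℝ} (hd : 0 < d)
    (hm : 0 < m) (hdm : d ≠ m) : h m + deriv h m * (d - m) < h d := by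
  have hder : HasDerivAt h (deriv h m) m :=
    ((hh.contDiffOn.differentiableOn one_ne_zero).differentiableAt (Ioi_mem_nhds hm)).hasDerivAt
  rcases hdm.lt_or_gt with hlt | hlt
  · have := hh.strictConvexOn.slope_lt_of_hasDerivAt hd hm hlt hder
    rw [slope_def_field, div_lt_iff₀ (by linarith)] at this
    linarith
  · have := hh.strictConvexOn.lt_slope_of_hasDerivAt hm hd hlt hder
    rw [slope_def_field, lt_div_iff₀ (by linarith)] at this
    linarith

theorem IsAdmissibleVolumetric.tangent_le (hh : IsAdmissibleVolumetric h) {d m : ℝ} (hd : 0 < d)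
    (hm : 0 < m) : h m + deriv h m * (d - m) ≤ h d := by
  rcases eq_or_ne d m with rfl | hdm
  · simp
  · exact (hh.tangent_lt hd hm hdm).le

/-- The contribution `Rⁿ⁻¹ h(δ(R))` of the compressibility term, with `δ = r' (r / R)ⁿ⁻¹`. -/
noncomputable def volumetricDensity (n : ℕ) (h r : ℝ → ℝ) (R : ℝ) : ℝ :=
  R ^ (n - 1) * h (deriv r R * (r R / R) ^ (n - 1))

variable {lam : ℝ} {r : ℝ → ℝ} {n : ℕ}

theorem aemeasurable_volumetricDensity (hh : IsAdmissibleVolumetric h) (hr : r ∈ admissible lam) :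
    AEMeasurable (volumetricDensity n h r) (volume.restrict (Ioo 0 1)) := by
  have hm : Measurable ((Ioi (0 : ℝ)).indicator h) := by
    classical
    rw [← piecewise_eq_indicator]
    exact hh.contDiffOn.continuousOn.measurable_piecewise continuousOn_const measurableSet_Ioi
  have hδ : AEMeasurable (fun R => deriv r R * (r R / R) ^ (n - 1)) (volume.restrict (Ioo 0 1)) :=
    (measurable_deriv r).aemeasurable.mul
      (((admissible.aemeasurable hr).div aemeasurable_id).pow_const _)
  refine ((aemeasurable_id.pow_const (n - 1)).mul (hm.comp_aemeasurable hδ)).congr ?_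
  refine (ae_restrict_iff' measurableSet_Ioo).2 ?_
  filter_upwards [admissible.ae_hasDerivAt hr] with R hR hmem
  have h1 := admissible.pos hr hmem.1 hmem.2.le
  have h2 := (hR hmem).2
  have h3 := hmem.1
  simp only [Pi.mul_apply, Function.comp, volumetricDensity, id]
  rw [indicator_of_mem]
  exact mem_Ioi.2 (by positivity)

theorem integrableOn_pow_Ioo (k : ℕ) : IntegrableOn (fun R : ℝ => R ^ k) (Ioo 0 1) :=
  ((continuous_pow k).integrableOn_Icc).mono_set Ioo_subset_Icc_self

theorem integral_pow_Ioo (hn : 1 ≤ n) : ∫ R in Ioo (0 : ℝ) 1, R ^ (n - 1) = 1 / n := by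
  rw [← integral_Ioc_eq_integral_Ioo, ← intervalIntegral.integral_of_le zero_le_one, integral_pow,
    Nat.sub_add_cancel hn]
  simp [show n ≠ 0 by omega, Nat.cast_sub hn]

theorem admissible.integral_Ioo_pow_mul_deriv (hr : r ∈ admissible lam) (hn : 1 ≤ n) :
    IntegrableOn (fun R => r R ^ (n - 1) * deriv r R) (Ioo 0 1) ∧
      ∫ R in Ioo 0 1, r R ^ (n - 1) * deriv r R = (lam ^ n - r 0 ^ n) / n := by
  obtain ⟨h1, h2⟩ := admissible.integral_pow_mul_deriv hr hn le_rfl zero_le_one le_rfl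
  rw [intervalIntegrable_iff_integrableOn_Ioo_of_le zero_le_one] at h1
  rw [intervalIntegral.integral_of_le zero_le_one, integral_Ioc_eq_integral_Ioo, hr.2.1] at h2
  exact ⟨h1, h2⟩

/-- The excess of the volumetric density over its tangent-line minorant at `m`. -/
noncomputable def volumetricExcess (n : ℕ) (h r : ℝ → ℝ) (m R : ℝ) : ℝ :=
  volumetricDensity n h r R
    - ((h m - deriv h m * m) * R ^ (n - 1) + deriv h m * (r R ^ (n - 1) * deriv r R))

theorem volumetricExcess_eq {m R : ℝ} (hR : 0 < R) :
    volumetricExcess n h r m R = R ^ (n - 1) * (h (deriv r R * (r R / R) ^ (n - 1))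
      - (h m + deriv h m * (deriv r R * (r R / R) ^ (n - 1) - m))) := by
  rw [volumetricExcess, volumetricDensity, div_pow]
  field_simp
  ring

theorem integral_volumetricExcess (hn : 1 ≤ n) (hr : r ∈ admissible lam) {m : ℝ}
    (hv : IntegrableOn (volumetricDensity n h r) (Ioo 0 1)) :
    IntegrableOn (volumetricExcess n h r m) (Ioo 0 1) ∧
      ∫ R in Ioo 0 1, volumetricExcess n h r m R = (∫ R in Ioo 0 1, volumetricDensity n h r R)
        - (h m / n + deriv h m * ((lam ^ n - r 0 ^ n - m) / n)) := by
  obtain ⟨h1, h2⟩ := admissible.integral_Ioo_pow_mul_deriv hr hn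
  have h3 := (integrableOn_pow_Ioo (n - 1)).const_mul (h m - deriv h m * m)
  have h4 := h1.const_mul (deriv h m)
  refine ⟨hv.sub (h3.add h4), ?_⟩
  refine (integral_sub hv (h3.add h4)).trans ?_
  rw [integral_add' h3 h4, integral_const_mul, integral_const_mul, h2,
    integral_pow_Ioo hn]
  ring

theorem volumetricExcess_nonneg (hh : IsAdmissibleVolumetric h) (hr : r ∈ admissible lam) {m : ℝ}
    (hm : 0 < m) : 0 ≤ᵐ[volume.restrict (Ioo 0 1)] volumetricExcess n h r m := by
  refine (ae_restrict_iff' measurableSet_Ioo).2 ?_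
  filter_upwards [admissible.ae_hasDerivAt hr] with R hR hmem
  have h1 := admissible.pos hr hmem.1 hmem.2.le
  have h2 := (hR hmem).2
  have h3 := hmem.1
  rw [volumetricExcess_eq hmem.1]
  have := hh.tangent_le (d := deriv r R * (r R / R) ^ (n - 1)) (by positivity) hm
  exact mul_nonneg (by positivity) (sub_nonneg.2 this)

/-- Jensen's inequality for the volumetric energy: the volume available to the material is
`(lamⁿ - r(0)ⁿ) / n`. -/
theorem integral_volumetricDensity_ge (hn : 1 ≤ n) (hh : IsAdmissibleVolumetric h)
    (hr : r ∈ admissible lam) {m : ℝ} (hm : 0 < m)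
    (hv : IntegrableOn (volumetricDensity n h r) (Ioo 0 1)) :
    h m / n + deriv h m * ((lam ^ n - r 0 ^ n - m) / n)
      ≤ ∫ R in Ioo 0 1, volumetricDensity n h r R := by
  have h1 := integral_nonneg_of_ae (volumetricExcess_nonneg (n := n) hh hr hm)
  rw [(integral_volumetricExcess hn hr hv).2] at h1
  linarith

/-- Equality in Jensen's inequality forces `δ` to be constant, hence `r` to be homogeneous. -/
theorem eq_mul_of_integral_volumetricDensity_le (hn : 1 ≤ n) (hh : IsAdmissibleVolumetric h)
    (hlam : 0 < lam) (hr : r ∈ admissible lam) (h0 : r 0 = 0)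
    (hv : IntegrableOn (volumetricDensity n h r) (Ioo 0 1))
    (hle : ∫ R in Ioo 0 1, volumetricDensity n h r R ≤ h (lam ^ n) / n) :
    ∀ R ∈ Icc (0 : ℝ) 1, r R = lam * R := by
  have hn0 : (0 : ℝ) < n := by exact_mod_cast hn
  have hne : n ≠ 0 := by omega
  have hm : 0 < lam ^ n := by positivity
  obtain ⟨hI, hE⟩ := integral_volumetricExcess (m := lam ^ n) hn hr hv
  have hnn := volumetricExcess_nonneg (n := n) hh hr hm
  have hzero : ∫ R in Ioo 0 1, volumetricExcess n h r (lam ^ n) R = 0 := by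
    refine le_antisymm ?_ (integral_nonneg_of_ae hnn)
    rw [hE, h0, zero_pow hne]
    simp only [sub_zero, sub_self, zero_div, mul_zero, add_zero]
    linarith
  rw [integral_eq_zero_iff_of_nonneg_ae hnn hI] at hzero
  have hzero' := (ae_restrict_iff' measurableSet_Ioo).1 hzero
  have hδ : ∀ᵐ R, R ∈ Ioo (0 : ℝ) 1 → r R ^ (n - 1) * deriv r R = lam ^ n * R ^ (n - 1) := by
    filter_upwards [admissible.ae_hasDerivAt hr, hzero'] with R hR hz hmem
    have h1 := admissible.pos hr hmem.1 hmem.2.le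
    have h2 := (hR hmem).2
    have h3 := hmem.1
    have hz' := hz hmem
    rw [volumetricExcess_eq hmem.1] at hz'
    have hd : deriv r R * (r R / R) ^ (n - 1) = lam ^ n := by
      by_contra hcon
      have := hh.tangent_lt (d := deriv r R * (r R / R) ^ (n - 1)) (by positivity) hm hcon
      have : 0 < R ^ (n - 1) * (h (deriv r R * (r R / R) ^ (n - 1))
        - (h (lam ^ n) + deriv h (lam ^ n) * (deriv r R * (r R / R) ^ (n - 1) - lam ^ n))) :=
        mul_pos (by positivity) (sub_pos.2 this)
      exact this.ne' hz'
    rw [← hd, div_pow]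
    field_simp
  intro R hR
  obtain ⟨-, hE'⟩ := admissible.integral_pow_mul_deriv hr hn le_rfl hR.1 hR.2
  have hcongr : ∫ x in (0 : ℝ)..R, r x ^ (n - 1) * deriv r x
      = ∫ x in (0 : ℝ)..R, lam ^ n * x ^ (n - 1) := by
    refine intervalIntegral.integral_congr_ae ?_
    filter_upwards [hδ, compl_mem_ae_iff.2 (measure_singleton (1 : ℝ))] with x hx h1 hmem
    rw [uIoc_of_le hR.1] at hmem
    exact hx ⟨hmem.1, (hmem.2.trans hR.2).lt_of_ne h1⟩
  have hpow : r R ^ n = (lam * R) ^ n := by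
    rw [hcongr, intervalIntegral.integral_const_mul, integral_pow, Nat.sub_add_cancel hn, h0,
      zero_pow hne, Nat.cast_sub hn] at hE'
    rw [mul_pow]
    simpa [hn0.ne', hne, ← mul_div_assoc, eq_comm, div_left_inj'] using hE'
  refine (pow_left_inj₀ ?_ ?_ hne).1 hpow
  · exact hr.2.2.2.trans (admissible.zero_le hr hR.1 hR.2)
  · exact mul_nonneg hlam.le hR.1

end Volumetric

/-! ### Integrals with values in the extended reals -/

section ExtendedIntegral

variable {s : Set ℝ} {f g : ℝ → ℝ}

theorem extendedIntegral_eq_integral (hf : IntegrableOn f s) :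
    extendedIntegral s f = ((∫ x in s, f x : ℝ) : EReal) := by
  rw [extendedIntegral, integral_eq_lintegral_pos_part_sub_lintegral_neg_part hf, EReal.coe_sub,
    EReal.coe_ennreal_toReal, EReal.coe_ennreal_toReal]
  · exact (hf.neg.lintegral_lt_top).ne
  · exact hf.lintegral_lt_top.ne

theorem extendedIntegral_mono (hs : MeasurableSet s) (hfg : ∀ x ∈ s, f x ≤ g x) :
    extendedIntegral s f ≤ extendedIntegral s g := by
  refine EReal.sub_le_sub (EReal.coe_ennreal_le_coe_ennreal_iff.2 ?_)
    (EReal.coe_ennreal_le_coe_ennreal_iff.2 ?_)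
  · exact setLIntegral_mono' hs fun x hx => ENNReal.ofReal_le_ofReal (hfg x hx)
  · exact setLIntegral_mono' hs fun x hx => ENNReal.ofReal_le_ofReal (neg_le_neg (hfg x hx))

/-- The integrable minorant rules out the value `⊤ - ⊤ = ⊥`. -/
theorem integrableOn_of_extendedIntegral_ne_top (hf : AEMeasurable f (volume.restrict s))
    (hg : IntegrableOn g s) (hgf : ∀ᵐ x ∂volume.restrict s, -g x ≤ f x)
    (hfin : extendedIntegral s f ≠ ⊤) : IntegrableOn f s := by
  have hneg : ∫⁻ x in s, ENNReal.ofReal (-f x) ≠ ∞ := by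
    refine ((lintegral_mono_ae ?_).trans_lt hg.lintegral_lt_top).ne
    filter_upwards [hgf] with x hx
    exact ENNReal.ofReal_le_ofReal (by linarith)
  have hpos : ∫⁻ x in s, ENNReal.ofReal (f x) ≠ ∞ := by
    intro htop
    refine hfin ?_
    rw [extendedIntegral, htop, ← EReal.coe_ennreal_toReal hneg, EReal.coe_ennreal_top,
      EReal.top_sub_coe]
  refine ⟨hf.aestronglyMeasurable, ?_⟩
  have hle : ∫⁻ x in s, ‖f x‖ₑ
      ≤ ∫⁻ x in s, (ENNReal.ofReal (f x) + ENNReal.ofReal (-f x)) := by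
    refine lintegral_mono fun x => ?_
    rw [Real.enorm_eq_ofReal_abs]
    rcases abs_cases (f x) with ⟨h, -⟩ | ⟨h, -⟩ <;> rw [h]
    · exact le_self_add
    · exact le_add_self
  refine hle.trans_lt ?_
  rw [lintegral_add_left' hf.ennreal_ofReal]
  exact ENNReal.add_lt_top.2 ⟨hpos.lt_top, hneg.lt_top⟩

end ExtendedIntegral

/-! ### The modified functional -/

section Functional

variable {h : ℝ → ℝ} {lam κ : ℝ} {r : ℝ → ℝ} {n : ℕ}

theorem pow_mul_modifiedEnergy (R : ℝ) :
    R ^ (n - 1) * modifiedEnergy n κ h (deriv r R) (r R / R)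
      = κ * dirichletDensity n r R + volumetricDensity n h r R := by
  rw [modifiedEnergy, dirichletDensity, volumetricDensity]
  ring

theorem modifiedFunctional_eq (hj : IntegrableOn (dirichletDensity n r) (Ioo 0 1))
    (hv : IntegrableOn (volumetricDensity n h r) (Ioo 0 1)) :
    modifiedFunctional n κ h lam r
      = ((κ * (∫ R in Ioo 0 1, dirichletDensity n r R)
          + (∫ R in Ioo 0 1, volumetricDensity n h r R)
          - κ * ((n : ℝ) - 1) / n * lam ^ n * Real.log lam : ℝ) : EReal) := by
  simp only [modifiedFunctional, pow_mul_modifiedEnergy]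
  rw [extendedIntegral_eq_integral ((hj.const_mul κ).fun_add hv),
    integral_add (hj.const_mul κ) hv, integral_const_mul, ← EReal.coe_sub]

/-- Both densities are integrable at finite energy: the volumetric one is nonnegative and the other
one is bounded below by a multiple of `r'`. -/
theorem integrableOn_of_modifiedFunctional_ne_top (hn : 2 ≤ n) (hκ : 0 < κ)
    (hh : IsAdmissibleVolumetric h) (hr : r ∈ admissible lam)
    (hfin : modifiedFunctional n κ h lam r ≠ ⊤) :
    IntegrableOn (dirichletDensity n r) (Ioo 0 1) ∧
      IntegrableOn (volumetricDensity n h r) (Ioo 0 1) := by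
  have hjm : AEMeasurable (dirichletDensity n r) (volume.restrict (Ioo 0 1)) := by
    have h1 : AEMeasurable (fun R => r R / R) (volume.restrict (Ioo 0 1)) :=
      (admissible.aemeasurable hr).div aemeasurable_id
    have h2 : AEMeasurable (deriv r) (volume.restrict (Ioo 0 1)) :=
      (measurable_deriv r).aemeasurable
    exact (aemeasurable_id.pow_const (n - 1)).mul (((h2.pow_const n).div_const _).add
      (((h2.mul (h1.pow_const (n - 1))).const_mul _).mul
        ((Real.measurable_log.comp_aemeasurable h1).const_add _)))
  have hvm := aemeasurable_volumetricDensity (n := n) hh hr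
  set C : ℝ → ℝ := fun R => κ * (((n : ℝ) - 1) * lam ^ (n - 2) * deriv r R) with hC
  have hCi : IntegrableOn C (Ioo 0 1) :=
    ((admissible.integrableOn_deriv hr).const_mul _).const_mul κ
  have hjC : ∀ᵐ R ∂volume.restrict (Ioo (0 : ℝ) 1), -C R ≤ κ * dirichletDensity n r R := by
    refine (ae_restrict_iff' measurableSet_Ioo).2 ?_
    filter_upwards [admissible.ae_hasDerivAt hr] with R hR hm
    rw [hC, ← mul_neg]
    exact mul_le_mul_of_nonneg_left (neg_le_dirichletDensity hn hm.1 hm.2.le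
      (admissible.pos hr hm.1 hm.2.le) (admissible.le hr hm.1.le hm.2.le) (hR hm).2) hκ.le
  have hv0 : ∀ᵐ R ∂volume.restrict (Ioo (0 : ℝ) 1), 0 ≤ volumetricDensity n h r R := by
    refine (ae_restrict_iff' measurableSet_Ioo).2 ?_
    filter_upwards [admissible.ae_hasDerivAt hr] with R hR hm
    have h1 := admissible.pos hr hm.1 hm.2.le
    have h2 := (hR hm).2
    have h3 := hm.1
    exact mul_nonneg (by positivity) (hh.nonneg _ (by positivity))
  have hf : IntegrableOn (fun R => κ * dirichletDensity n r R + volumetricDensity n h r R)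
      (Ioo 0 1) := by
    refine integrableOn_of_extendedIntegral_ne_top ((hjm.const_mul κ).add hvm) hCi ?_ ?_
    · filter_upwards [hjC, hv0] with R h1 h2
      linarith
    · intro htop
      refine hfin ?_
      simp only [modifiedFunctional, pow_mul_modifiedEnergy]
      rw [htop, EReal.top_sub_coe]
  have hv : IntegrableOn (volumetricDensity n h r) (Ioo 0 1) := by
    refine Integrable.mono' (hf.add hCi) hvm.aestronglyMeasurable ?_
    filter_upwards [hjC, hv0] with R h1 h2
    rw [Real.norm_of_nonneg h2]
    simp only [Pi.add_apply]
    linarith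
  refine ⟨?_, hv⟩
  have := (hf.sub hv).const_mul κ⁻¹
  refine this.congr (Eventually.of_forall fun R => ?_)
  simp only [Pi.sub_apply, add_sub_cancel_right]
  rw [← mul_assoc, inv_mul_cancel₀ hκ.ne', one_mul]

/-! ### The homogeneous deformation -/

theorem linear_mem_admissible (hlam : 0 < lam) : (fun R => lam * R) ∈ admissible lam := by
  refine ⟨ContDiffOn.absolutelyContinuousOnInterval (by fun_prop), by simp, ?_, by simp⟩
  refine Eventually.of_forall fun R => ?_
  simp [hlam]

theorem modifiedFunctional_linear (hn : 1 ≤ n) :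
    modifiedFunctional n κ h lam (fun R => lam * R)
      = ((h (lam ^ n) / n + κ * lam ^ n / n : ℝ) : EReal) := by
  have hn0 : (0 : ℝ) < n := by exact_mod_cast hn
  have hd : ∀ R : ℝ, deriv (fun R => lam * R) R = lam := fun R => by
    simp
  have hpow : lam * lam ^ (n - 1) = lam ^ n := mul_pow_sub_one (by omega) lam
  have hj : EqOn (dirichletDensity n (fun R => lam * R)) (fun R => R ^ (n - 1) *
      (lam ^ n / n + ((n : ℝ) - 1) * lam ^ n * (1 / n + Real.log lam))) (Ioo 0 1) := by
    intro R hR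
    simp only [dirichletDensity, hd, mul_div_assoc, div_self hR.1.ne', mul_one, hpow]
  have hv : EqOn (volumetricDensity n h (fun R => lam * R)) (fun R => R ^ (n - 1) * h (lam ^ n))
      (Ioo 0 1) := by
    intro R hR
    simp only [volumetricDensity, hd, mul_div_assoc, div_self hR.1.ne', mul_one, hpow]
  rw [modifiedFunctional_eq
    (IntegrableOn.congr_fun ((integrableOn_pow_Ioo (n - 1)).mul_const _) hj.symm
      measurableSet_Ioo)
    (IntegrableOn.congr_fun ((integrableOn_pow_Ioo (n - 1)).mul_const _) hv.symm
      measurableSet_Ioo),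
    setIntegral_congr_fun measurableSet_Ioo hj, setIntegral_congr_fun measurableSet_Ioo hv,
    integral_mul_const, integral_mul_const, integral_pow_Ioo hn]
  congr 1
  field_simp
  ring

/-! ### A cavitating competitor -/

/-- The deformation that opens a cavity of radius `D^(1/n)` and has constant Jacobian `D`. It takes
the value `lam` at `R = 1` for `D = lamⁿ / 2`. -/
noncomputable def cavity (n : ℕ) (D R : ℝ) : ℝ := (D * R ^ n + D) ^ ((n : ℝ)⁻¹)

section Cavity

variable {D R : ℝ}

theorem cavity_pow (hn : 1 ≤ n) (hD : 0 < D) (hR : 0 ≤ R) :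
    cavity n D R ^ n = D * R ^ n + D :=
  Real.rpow_inv_natCast_pow (by positivity) (by omega)

theorem cavity_pos (hD : 0 < D) (hR : 0 ≤ R) : 0 < cavity n D R :=
  Real.rpow_pos_of_pos (by positivity) _

theorem hasDerivAt_cavity (hn : 1 ≤ n) (hD : 0 < D) (hR : 0 < R) :
    HasDerivAt (cavity n D) (D * (R / cavity n D R) ^ (n - 1)) R := by
  have hn0 : (0 : ℝ) < n := by exact_mod_cast hn
  have hb : HasDerivAt (fun R : ℝ => D * R ^ n + D) (D * (n * R ^ (n - 1))) R :=
    ((hasDerivAt_pow n R).const_mul D).add_const D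
  have h1 := hb.rpow_const (p := (n : ℝ)⁻¹) (Or.inl (by positivity))
  refine h1.congr_deriv ?_
  have hc := cavity_pos (n := n) hD hR.le
  have h2 : (D * R ^ n + D) ^ ((n : ℝ)⁻¹ - 1) = (cavity n D R ^ (n - 1))⁻¹ := by
    rw [Real.rpow_sub_one (by positivity), ← cavity_pow hn hD hR.le, cavity_pow hn hD hR.le,
      ← cavity, ← cavity_pow hn hD hR.le, ← pow_sub_one_mul (by omega : n ≠ 0)]
    field_simp
  rw [h2, div_pow]
  field_simp

theorem cavity_mem_admissible (hn : 1 ≤ n) (hlam : 0 < lam) :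
    cavity n (lam ^ n / 2) ∈ admissible lam := by
  have hD : 0 < lam ^ n / 2 := by positivity
  refine ⟨ContDiffOn.absolutelyContinuousOnInterval fun R hR => ?_, ?_, ?_, ?_⟩
  · rw [uIcc_of_le zero_le_one] at hR
    have hR0 := hR.1
    refine ContDiffAt.contDiffWithinAt ?_
    exact ContDiffAt.rpow_const_of_ne (by fun_prop) (by positivity)
  · rw [cavity, one_pow, mul_one, add_halves, Real.pow_rpow_inv_natCast hlam.le (by omega)]
  · refine (ae_restrict_iff' measurableSet_Ioo).2 (Eventually.of_forall fun R hR => ?_)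
    have hc := cavity_pos (n := n) hD hR.1.le
    have hR0 := hR.1
    rw [(hasDerivAt_cavity hn hD hR.1).deriv]
    positivity
  · exact (cavity_pos hD le_rfl).le

/-- The bound uses `qⁿ ≤ D` and `r ≤ lam` for the competitor `r`. -/
theorem pow_mul_modifiedEnergy_cavity_le (hn : 2 ≤ n) (hκ : 0 < κ) (hlam : 0 < lam)
    (hR : R ∈ Ioo (0 : ℝ) 1) (hD : D = lam ^ n / 2) :
    R ^ (n - 1) * modifiedEnergy n κ h (deriv (cavity n D) R) (cavity n D R / R)
      ≤ (κ * D / n + h D + κ * ((n : ℝ) - 1) * D * (1 / n + Real.log lam)) * R ^ (n - 1)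
        + -(κ * ((n : ℝ) - 1) * D) * (R ^ (n - 1) * Real.log R) := by
  have hn2 : (2 : ℝ) ≤ n := by exact_mod_cast hn
  have hn1 : 0 ≤ (n : ℝ) - 1 := by linarith
  have hD0 : 0 < D := by rw [hD]; positivity
  have hR0 := hR.1
  have hc := cavity_pos (n := n) hD0 hR.1.le
  have hcp := cavity_pow (n := n) (by omega) hD0 hR.1.le
  rw [(hasDerivAt_cavity (by omega) hD0 hR.1).deriv]
  have hδ : D * (R / cavity n D R) ^ (n - 1) * (cavity n D R / R) ^ (n - 1) = D := by
    rw [div_pow, div_pow]; field_simp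
  have hq : (D * (R / cavity n D R) ^ (n - 1)) ^ n ≤ D := by
    have h1 : (R / cavity n D R) ^ n ≤ D⁻¹ := by
      rw [div_pow, hcp, div_le_iff₀ (by positivity), mul_add, ← mul_assoc,
        inv_mul_cancel₀ hD0.ne']
      linarith
    calc (D * (R / cavity n D R) ^ (n - 1)) ^ n = D ^ n * ((R / cavity n D R) ^ n) ^ (n - 1) := by
          rw [mul_pow, pow_right_comm]
      _ ≤ D ^ n * D⁻¹ ^ (n - 1) := by gcongr
      _ = D := by
        rw [← mul_pow_sub_one (by omega : n ≠ 0) D, mul_assoc, ← mul_pow,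
          mul_inv_cancel₀ hD0.ne', one_pow, mul_one]
  have hlog : Real.log (cavity n D R / R) ≤ Real.log lam - Real.log R := by
    rw [Real.log_div hc.ne' hR.1.ne']
    have hle : cavity n D R ≤ lam := by
      refine le_of_pow_le_pow_left₀ (by omega : n ≠ 0) hlam.le ?_
      rw [hcp]
      have : R ^ n ≤ 1 := pow_le_one₀ hR.1.le hR.2.le
      have := mul_le_mul_of_nonneg_left this hD0.le
      linarith
    have := Real.log_le_log hc hle
    linarith
  have hE : modifiedEnergy n κ h (D * (R / cavity n D R) ^ (n - 1)) (cavity n D R / R)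
      ≤ κ / n * D + h D + κ * ((n : ℝ) - 1) * D * (1 / n + (Real.log lam - Real.log R)) := by
    rw [modifiedEnergy, hδ]
    gcongr
  refine (mul_le_mul_of_nonneg_left hE (by positivity : 0 ≤ R ^ (n - 1))).trans (le_of_eq ?_)
  ring

theorem integral_pow_mul_log (hn : 2 ≤ n) :
    IntegrableOn (fun R => R ^ (n - 1) * Real.log R) (Ioo 0 1) ∧
      ∫ R in Ioo (0 : ℝ) 1, R ^ (n - 1) * Real.log R = -(1 / (n : ℝ) ^ 2) := by
  have hn0 : (0 : ℝ) < n := by exact_mod_cast (by omega : 0 < n)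
  have hcont : ∀ k : ℕ, 1 ≤ k → Continuous fun R : ℝ => R ^ k * Real.log R := by
    intro k hk
    have : Continuous fun R : ℝ => R ^ (k - 1) * (R * Real.log R) :=
      (continuous_pow _).mul Real.continuous_mul_log
    refine this.congr fun R => ?_
    rw [← mul_assoc, pow_sub_one_mul (by omega)]
  refine ⟨((hcont (n - 1) (by omega)).integrableOn_Icc).mono_set Ioo_subset_Icc_self, ?_⟩
  rw [← integral_Ioc_eq_integral_Ioo, ← intervalIntegral.integral_of_le zero_le_one,
    intervalIntegral.integral_eq_sub_of_hasDerivAt_of_le zero_le_one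
      (f := fun R => R ^ n * Real.log R / n - R ^ n / n ^ 2)
      (((hcont n (by omega)).div_const _).sub (by fun_prop)).continuousOn ?_
      ((hcont (n - 1) (by omega)).intervalIntegrable _ _)]
  · simp [show n ≠ 0 by omega]
  · intro R hR
    have hd := (((hasDerivAt_pow n R).mul (Real.hasDerivAt_log hR.1.ne')).div_const (n : ℝ)).sub
      ((hasDerivAt_pow n R).div_const ((n : ℝ) ^ 2))
    refine hd.congr_deriv ?_
    have hR0 := hR.1
    rw [← pow_sub_one_mul (by omega : n ≠ 0) R]
    field_simp
    ring

theorem modifiedFunctional_cavity_le (hn : 2 ≤ n) (hκ : 0 < κ) (hlam : 0 < lam)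
    (hD : D = lam ^ n / 2) :
    modifiedFunctional n κ h lam (cavity n D)
      ≤ ((h D / n + κ * D * (2 * n - 1) / n ^ 2
          - κ * ((n : ℝ) - 1) / n * D * Real.log lam : ℝ) : EReal) := by
  have hn0 : (0 : ℝ) < n := by exact_mod_cast (by omega : 0 < n)
  obtain ⟨hI, hE⟩ := integral_pow_mul_log hn
  have h1 := (integrableOn_pow_Ioo (n - 1)).const_mul
    (κ * D / n + h D + κ * ((n : ℝ) - 1) * D * (1 / n + Real.log lam))
  have h2 := hI.const_mul (-(κ * ((n : ℝ) - 1) * D))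
  have hle := extendedIntegral_mono measurableSet_Ioo
    (fun R hR => pow_mul_modifiedEnergy_cavity_le (h := h) hn hκ hlam hR hD)
  rw [extendedIntegral_eq_integral (h1.fun_add h2), integral_add h1 h2, integral_const_mul,
    integral_const_mul, hE, integral_pow_Ioo (by omega)] at hle
  refine (EReal.sub_le_sub hle le_rfl).trans (le_of_eq ?_)
  rw [← EReal.coe_sub]
  congr 1
  rw [show lam ^ n = 2 * D by rw [hD]; ring]
  field_simp
  ring

end Cavity

end Functional

/-! ### Comparison with the homogeneous deformation -/

section Comparison

variable {h : ℝ → ℝ} {lam κ : ℝ} {r : ℝ → ℝ} {n : ℕ}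

theorem modifiedStress_self (hn : 1 ≤ n) (κ : ℝ) (hh : IsAdmissibleVolumetric h) {l : ℝ}
    (hl : 0 < l) :
    modifiedStress n κ h l l = κ + deriv h (l ^ n) + ((n : ℝ) - 1) * κ * (1 / n + Real.log l) := by
  rw [modifiedStress_eq hn κ hh.contDiffOn hl hl, div_self hl.ne', one_pow, mul_one,
    mul_pow_sub_one (by omega)]

theorem strictMonoOn_modifiedStress_self (hn : 1 ≤ n) (hκ : 0 < κ)
    (hh : IsAdmissibleVolumetric h) :
    StrictMonoOn (fun l => modifiedStress n κ h l l) (Ioi 0) := by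
  intro a (ha : 0 < a) b (hb : 0 < b) hab
  have hn1 : 0 ≤ (n : ℝ) - 1 := by
    have : (1 : ℝ) ≤ n := by exact_mod_cast hn
    linarith
  simp only
  rw [modifiedStress_self hn κ hh ha, modifiedStress_self hn κ hh hb]
  have h1 : deriv h (a ^ n) < deriv h (b ^ n) :=
    hh.strictMonoOn_deriv (pow_pos ha n) (pow_pos hb n) (pow_lt_pow_left₀ hab ha.le (by omega))
  have h2 : ((n : ℝ) - 1) * κ * (1 / n + Real.log a) ≤ ((n : ℝ) - 1) * κ * (1 / n + Real.log b) := by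
    gcongr
  linarith

theorem exists_modifiedStress_self_eq_zero (hn : 1 ≤ n) (hκ : 0 < κ)
    (hh : IsAdmissibleVolumetric h) : ∃ l, 0 < l ∧ modifiedStress n κ h l l = 0 := by
  have hn0 : n ≠ 0 := by omega
  have hn1 : 0 ≤ (n : ℝ) - 1 := by
    have : (1 : ℝ) ≤ n := by exact_mod_cast hn
    linarith
  have hcont : ContinuousOn (fun l => modifiedStress n κ h l l) (Ioi 0) := by
    refine ContinuousOn.congr (f := fun l =>
      κ + deriv h (l ^ n) + ((n : ℝ) - 1) * κ * (1 / n + Real.log l)) ?_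
      fun l hl => modifiedStress_self hn κ hh hl
    refine ContinuousOn.add (continuousOn_const.add ?_) (continuousOn_const.mul
      (continuousOn_const.add (Real.continuousOn_log.mono fun x hx => (mem_Ioi.1 hx).ne')))
    exact hh.continuousOn_deriv.comp (continuous_pow n).continuousOn fun x hx =>
      mem_Ioi.2 (pow_pos (mem_Ioi.1 hx) n)
  obtain ⟨a, ha0, ha1, ha⟩ : ∃ a, 0 < a ∧ a < 1 ∧ modifiedStress n κ h a a < 0 := by
    have hpow : Tendsto (fun l : ℝ => l ^ n) (𝓝[>] 0) (𝓝[>] 0) := by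
      refine tendsto_nhdsWithin_iff.2 ⟨?_, ?_⟩
      · have := ((continuous_pow n).tendsto (0 : ℝ)).mono_left (nhdsWithin_le_nhds (s := Ioi 0))
        rwa [zero_pow hn0] at this
      · filter_upwards [self_mem_nhdsWithin] with l hl using pow_pos (mem_Ioi.1 hl) n
    have h1 := (hh.deriv_tendsto_zero.comp hpow).eventually
      (eventually_lt_atBot (-(κ + ((n : ℝ) - 1) * κ * (1 / n))))
    obtain ⟨a, ha, ha2⟩ := (h1.and (Ioo_mem_nhdsGT zero_lt_one)).exists
    refine ⟨a, ha2.1, ha2.2, ?_⟩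
    rw [modifiedStress_self hn κ hh ha2.1, mul_add]
    have := mul_nonpos_of_nonneg_of_nonpos (mul_nonneg hn1 hκ.le)
      (Real.log_nonpos ha2.1.le ha2.2.le)
    simp only [Function.comp] at ha
    linarith
  obtain ⟨b, hb1, hb⟩ : ∃ b, 1 < b ∧ 0 < modifiedStress n κ h b b := by
    have h1 := (hh.deriv_tendsto_atTop.comp (tendsto_pow_atTop hn0)).eventually
      (eventually_gt_atTop 0)
    obtain ⟨b, hb, hb1⟩ := (h1.and (eventually_gt_atTop 1)).exists
    refine ⟨b, hb1, ?_⟩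
    rw [modifiedStress_self hn κ hh (by linarith)]
    have := mul_nonneg (mul_nonneg hn1 hκ.le)
      (add_nonneg (by positivity : (0 : ℝ) ≤ 1 / n) (Real.log_nonneg hb1.le))
    simp only [Function.comp] at hb
    linarith
  obtain ⟨l, hl, hl0⟩ := intermediate_value_Icc (ha1.trans hb1).le
    (hcont.mono fun x hx => ha0.trans_le hx.1) ⟨ha.le, hb.le⟩
  exact ⟨l, ha0.trans_le hl.1, hl0⟩

/-- The energy of `r` compared with that of the homogeneous deformation: opening a cavity of radius
`r 0` gains at most `(r(0)ⁿ / n) T̂(lam, lam)` and costs a positive remainder. -/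
theorem energy_ge (hn : 2 ≤ n) (hκ : 0 < κ) (hh : IsAdmissibleVolumetric h) (hlam : 0 < lam)
    (hr : r ∈ admissible lam) (hj : IntegrableOn (dirichletDensity n r) (Ioo 0 1))
    (hv : IntegrableOn (volumetricDensity n h r) (Ioo 0 1)) :
    h (lam ^ n) / n + κ * lam ^ n / n + κ * r 0 ^ (2 * n) / (n ^ 2 * lam ^ n)
        - r 0 ^ n / n * modifiedStress n κ h lam lam
      ≤ κ * (∫ R in Ioo 0 1, dirichletDensity n r R)
          + (∫ R in Ioo 0 1, volumetricDensity n h r R)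
          - κ * ((n : ℝ) - 1) / n * lam ^ n * Real.log lam := by
  have hn2 : (2 : ℝ) ≤ n := by exact_mod_cast hn
  have h1 := mul_le_mul_of_nonneg_left (integral_dirichletDensity_ge hn hr hj) hκ.le
  have h2 := integral_volumetricDensity_ge (by omega) hh hr (pow_pos hlam n) hv
  rw [modifiedStress_self (by omega) κ hh hlam]
  have h3 : 0 ≤ κ * (r 0 ^ n * ((n : ℝ) - 2) / n ^ 2) :=
    mul_nonneg hκ.le (div_nonneg (mul_nonneg (pow_nonneg hr.2.2.2 n) (by linarith)) (by positivity))
  have h4 : κ * (lam ^ n / n + r 0 ^ (2 * n) / (n ^ 2 * lam ^ n) - r 0 ^ n * (n + 1) / n ^ 2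
        + ((n : ℝ) - 1) / n * ((lam ^ n - r 0 ^ n) * Real.log lam))
      + (h (lam ^ n) / n + deriv h (lam ^ n) * ((lam ^ n - r 0 ^ n - lam ^ n) / n))
      - κ * ((n : ℝ) - 1) / n * lam ^ n * Real.log lam
      = h (lam ^ n) / n + κ * lam ^ n / n + κ * r 0 ^ (2 * n) / (n ^ 2 * lam ^ n)
        - r 0 ^ n / n * (κ + deriv h (lam ^ n) + ((n : ℝ) - 1) * κ * (1 / n + Real.log lam))
        + κ * (r 0 ^ n * ((n : ℝ) - 2) / n ^ 2) := by
    field_simp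
    ring
  linarith

/-- For a nonpositive stress `T̂(lam, lam)` the cavity costs energy, and equality in Jensen's
inequality does the rest. -/
theorem IsMinimizer.eq_mul (hn : 2 ≤ n) (hκ : 0 < κ) (hh : IsAdmissibleVolumetric h)
    (hlam : 0 < lam) (hT : modifiedStress n κ h lam lam ≤ 0) (hmin : IsMinimizer n κ h lam r) :
    ∀ R ∈ Icc (0 : ℝ) 1, r R = lam * R := by
  obtain ⟨hr, hmin⟩ := hmin
  have hn0 : (0 : ℝ) < n := by exact_mod_cast (by omega : 0 < n)
  have hle := isMinOn_iff.1 hmin _ (linear_mem_admissible hlam)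
  rw [modifiedFunctional_linear (by omega)] at hle
  obtain ⟨hj, hv⟩ := integrableOn_of_modifiedFunctional_ne_top hn hκ hh hr
    (hle.trans_lt (EReal.coe_lt_top _)).ne
  rw [modifiedFunctional_eq hj hv, EReal.coe_le_coe_iff] at hle
  have hge := energy_ge hn hκ hh hlam hr hj hv
  have h0 : r 0 = 0 := by
    by_contra hne
    have hpos : 0 < r 0 := hr.2.2.2.lt_of_ne' hne
    have h1 : 0 < κ * r 0 ^ (2 * n) / (n ^ 2 * lam ^ n) := by positivity
    have h2 := mul_nonpos_of_nonneg_of_nonpos (by positivity : 0 ≤ r 0 ^ n / n) hT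
    linarith
  refine eq_mul_of_integral_volumetricDensity_le (by omega) hh hlam hr h0 hv ?_
  have h1 := mul_le_mul_of_nonneg_left (integral_dirichletDensity_ge hn hr hj) hκ.le
  rw [h0, zero_pow (by omega : 2 * n ≠ 0), zero_pow (by omega : n ≠ 0)] at h1
  have h2 : κ * (lam ^ n / n + 0 / (n ^ 2 * lam ^ n) - 0 * (n + 1) / n ^ 2
      + ((n : ℝ) - 1) / n * ((lam ^ n - 0) * Real.log lam))
      = κ * lam ^ n / n + κ * ((n : ℝ) - 1) / n * lam ^ n * Real.log lam := by ring
  linarith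

/-- Without a cavity the energy is at least that of the homogeneous deformation, which is beaten by
the deformation `cavity` as soon as `h` is nondecreasing beyond `lamⁿ / 2`. -/
theorem IsMinimizer.pos_zero (hn : 2 ≤ n) (hκ : 0 < κ) (hh : IsAdmissibleVolumetric h)
    (hlam : 1 ≤ lam) (hderiv : 0 ≤ deriv h (lam ^ n / 2)) (hmin : IsMinimizer n κ h lam r) :
    0 < r 0 := by
  obtain ⟨hr, hmin⟩ := hmin
  have hlam0 : 0 < lam := by linarith
  have hn2 : (2 : ℝ) ≤ n := by exact_mod_cast hn
  refine hr.2.2.2.lt_of_ne fun h0 => ?_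
  have hle := (isMinOn_iff.1 hmin _ (cavity_mem_admissible (by omega) hlam0)).trans
    (modifiedFunctional_cavity_le hn hκ hlam0 rfl)
  obtain ⟨hj, hv⟩ := integrableOn_of_modifiedFunctional_ne_top hn hκ hh hr
    (hle.trans_lt (EReal.coe_lt_top _)).ne
  rw [modifiedFunctional_eq hj hv, EReal.coe_le_coe_iff] at hle
  have hge := energy_ge hn hκ hh hlam0 hr hj hv
  rw [← h0, zero_pow (by omega : 2 * n ≠ 0), zero_pow (by omega : n ≠ 0)] at hge
  set D : ℝ := lam ^ n / 2 with hD
  have hD0 : 0 < D := by positivity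
  rw [show lam ^ n = 2 * D by rw [hD]; ring] at hge hle
  have h1 : h D ≤ h (2 * D) := by
    have h2 := hh.tangent_le (d := 2 * D) (m := D) (by positivity) hD0
    have h3 := mul_nonneg hderiv (by linarith : 0 ≤ 2 * D - D)
    linarith
  have h2 : h D / n ≤ h (2 * D) / n := by gcongr
  have h3 : 0 ≤ κ * ((n : ℝ) - 1) / n * D * Real.log lam := by
    have : 0 ≤ (n : ℝ) - 1 := by linarith
    have := Real.log_nonneg hlam
    positivity
  have h4 : κ * D * (2 * n - 1) / n ^ 2 < κ * (2 * D) / n := by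
    have : κ * (2 * D) / n - κ * D * (2 * n - 1) / n ^ 2 = κ * D / n ^ 2 := by
      field_simp
      ring
    have h5 : 0 < κ * D / n ^ 2 := by positivity
    linarith
  simp only [mul_zero, zero_div, zero_mul, add_zero, sub_zero] at hge
  linarith

end Comparison

end RadialCavitation

theorem mainTheorem6 (n : ℕ) (hn : 2 ≤ n) (κ : ℝ) (hκ : 0 < κ) (h : ℝ → ℝ)
    (hh : RadialCavitation.IsAdmissibleVolumetric h) (hgrowth : RadialCavitation.DerivGrowth h) :
    ∃ lamBar : ℝ,
      (0 < lamBar ∧ RadialCavitation.modifiedStress n κ h lamBar lamBar = 0 ∧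
        ∀ l : ℝ, 0 < l → RadialCavitation.modifiedStress n κ h l l = 0 → l = lamBar) ∧
      (∀ lam : ℝ, 0 < lam → lam < lamBar → ∀ r : ℝ → ℝ,
        RadialCavitation.IsMinimizer n κ h lam r → ∀ R ∈ Set.Icc (0 : ℝ) 1, r R = lam * R) ∧
      (∃ lamLarge : ℝ, 0 < lamLarge ∧ ∀ lam : ℝ, lamLarge < lam → ∀ r : ℝ → ℝ,
        RadialCavitation.IsMinimizer n κ h lam r → 0 < r 0) := by
  have hmono := RadialCavitation.strictMonoOn_modifiedStress_self (by omega : 1 ≤ n) hκ hh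
  obtain ⟨lamBar, hpos, hzero⟩ :=
    RadialCavitation.exists_modifiedStress_self_eq_zero (by omega : 1 ≤ n) hκ hh
  refine ⟨lamBar, ⟨hpos, hzero, fun l hl hl0 => hmono.injOn hl hpos (hl0.trans hzero.symm)⟩,
    fun lam hlam hlt r hr => ?_, ?_⟩
  · exact hr.eq_mul hn hκ hh hlam ((hmono hlam hpos hlt).le.trans hzero.le)
  · -- Beyond `lam = 2 d` with `lam ≥ 1`, also `lamⁿ / 2 ≥ d`, so that `h'(lamⁿ / 2) ≥ 0`.
    obtain ⟨d, hd⟩ :=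
      (hh.deriv_tendsto_atTop.eventually (eventually_ge_atTop 0)).exists_forall_of_atTop
    refine ⟨max 1 (2 * d), by positivity, fun lam hlam r hr => ?_⟩
    have h1 : 1 < lam := (le_max_left _ _).trans_lt hlam
    have h2 : 2 * d < lam := (le_max_right _ _).trans_lt hlam
    have h3 : lam ≤ lam ^ n := le_self_pow₀ h1.le (by omega)
    exact hr.pos_zero hn hκ hh h1.le (hd _ (by linarith))
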